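/- **Model.** In the synchronous KT-1 CONGEST model the input is an $n$-node graph (not necessarily connected), which is also the communication network; nodes have distinct IDs from a totally ordered ID space of size $N\ge n$. Initially a node knows its own ID and the IDs of its neighbours, it may know $n$ (and $N$), and in every round it may send one message to each neighbour. An algorithm has message-size constant $\kappa$ if every message carries at most $\kappa\log_2 n$ ordinary bits and at most $\kappa$ IDs. The algorithm is comparison-based if each node keeps the IDs it knows in ID-type variables, whose values may only be sent in messages and compared with each other, while arbitrary computations are allowed on ordinary data (results of comparisons, received bits, random seeds). It is randomized if every node has private randomness, independent over nodes and rounds. An execution computes a maximal independent set (MIS) if the nodes' outputs are eventually fixed and the set of nodes that output "in" is an MIS; the number of rounds is not restricted. **Theorem.** For every $\kappa$ there is a constant $c>0$ such that for every constant $\varepsilon\in[0,1)$ there is an $n_0$ for which the following holds for all $n\ge n_0$ and all $N\ge n$. Let $\mathcal A$ be a randomized (Monte Carlo) comparison-based KT-1 CONGEST algorithm with message-size constant $\kappa$ (it may depend on $n$ and $N$) that computes an MIS with error probability at most $\varepsilon$ on every $n$-node graph with every assignment of distinct IDs from the ID space of size $N$. Then there are an $n$-node graph and an ID assignment on which the expected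 number of messages sent by $\mathcal A$ is at least $c(1-\varepsilon)n^2$. In particular, the worst-case message complexity of $\mathcal A$ is $\Omega((1-\varepsilon)n^2)$, even if the nodes know $n$; the case $\varepsilon=0$ includes deterministic algorithms. -/

import Mathlib

open MeasureTheory Filter
open scoped ENNReal

noncomputable section

namespace Congest

/-- An input network: a graph on the node set `V` together with unique node IDs from the ID space
`{0, …, N - 1}`. The graph is also the communication network; it need not be connected. -/
structure Network (V : Type) (N : ℕ) where
  graph : SimpleGraph V
  id : V ↪ Fin N

namespace Network

variable {V : Type} [Fintype V] {N : ℕ}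

open Classical in
/-- The neighbours of `v`, listed by increasing ID. Position `i` of this list is port `i` of `v`. -/
def nbrs (nw : Network V N) (v : V) : List V :=
  letI := LinearOrder.lift' nw.id nw.id.injective
  (Finset.univ.filter fun u => nw.graph.Adj v u).sort

/-- KT-1 initial knowledge: the ID of `v` itself, followed by the IDs of all its neighbours. -/
def initIds (nw : Network V N) (v : V) : List (Fin N) :=
  nw.id v :: (nw.nbrs v).map nw.id

end Network

/-- A message: ordinary bits, and a list of entries of type `ι` for the ID-type part.
`ι = ℕ` (positions in the sender's list of ID-type variables) in a program,
`ι = Fin N` (actual IDs) when the message travels. -/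
structure Message (ι : Type) where
  bits : List Bool
  ids : List ι

/-- The results of comparing (`<`, `=` or `>`) all pairs of ID-type variables of a node. -/
def cmpTable {N : ℕ} (l : List (Fin N)) : List (List Ordering) :=
  l.map fun a => l.map fun b => compare a b

/-- A randomized comparison-based program, executed by every node. A node has an ordinary state
of type `State` (with no restriction on the computation performed on it) and a list of ID-type
variables, which the program reads only through the table of their pairwise comparisons.
No variable is ever overwritten: every ID known initially or received later stays in the list.

* `coin`: the distribution of the private random seed that a node draws afresh in every round;
* `init`: the initial ordinary state, from the comparisons among the initial IDs and a seed;
* `send s i`: the message, if any, that a node in state `s` sends through port `i`; its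
  `ids` are the positions of the ID-type variables whose values are sent;
* `step`: the new ordinary state, from the old one, the comparisons among all ID-type variables
  (including those just received), the ordinary content of the messages received (port by port:
  the bits and the number of IDs), and a fresh seed;
* `output`: the node's decision, if it has made one (`true`: in the set, `false`: not in it). -/
structure Algorithm where
  State : Type
  coin : PMF ℕ
  init : List (List Ordering) → ℕ → State
  send : State → ℕ → Option (Message ℕ)
  step : State → List (List Ordering) → List (Option (List Bool × ℕ)) → ℕ → State
  output : State → Option Bool

namespace Algorithm

variable {V : Type} [Fintype V] {N : ℕ} (A : Algorithm)

/-- The bandwidth restriction for networks with `n` nodes, with constant `κ`: every message has at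
most `κ * log₂ n` ordinary bits and at most `κ` IDs. -/
def IsCongest (κ n : ℕ) : Prop :=
  ∀ s i m, A.send s i = some m → m.bits.length ≤ κ * Nat.log 2 n ∧ m.ids.length ≤ κ

/-- A global configuration: the ordinary state and the ID-type variables of every node. -/
abbrev Config (V : Type) (N : ℕ) : Type := V → A.State × List (Fin N)

open Classical in
/-- The message that `u` sends to its neighbour `v` in a configuration. Positions that do not exist
in the sender's list of ID-type variables are dropped. -/
def sent (nw : Network V N) (c : A.Config V N) (u v : V) : Option (Message (Fin N)) :=
  (A.send (c u).1 ((nw.nbrs u).idxOf v)).map fun m =>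
    ⟨m.bits, m.ids.filterMap fun k => (c u).2[k]?⟩

/-- The messages that arrive at `v`, port by port. -/
def inbox (nw : Network V N) (c : A.Config V N) (v : V) : List (Option (Message (Fin N))) :=
  (nw.nbrs v).map fun u => A.sent nw c u v

/-- One synchronous round: all messages are sent and delivered, the received IDs are appended to
the ID-type variables, and every node updates its ordinary state. -/
def round (nw : Network V N) (c : A.Config V N) (seed : V → ℕ) : A.Config V N := fun v =>
  let ids := (c v).2 ++ (A.inbox nw c v).flatMap fun o => o.elim [] Message.ids
  (A.step (c v).1 (cmpTable ids)
    ((A.inbox nw c v).map (Option.map fun m => (m.bits, m.ids.length))) (seed v), ids)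

/-- The configuration at the beginning of round `r`, where `ω (v, r)` is the seed that node `v`
draws at time `r`. -/
def config (nw : Network V N) (ω : V × ℕ → ℕ) : ℕ → A.Config V N
  | 0 => fun v => (A.init (cmpTable (nw.initIds v)) (ω (v, 0)), nw.initIds v)
  | r + 1 => A.round nw (config nw ω r) fun v => ω (v, r + 1)

/-- The number of messages sent by all nodes in one round. -/
def roundMessages (nw : Network V N) (c : A.Config V N) : ℕ :=
  ∑ v, (nw.nbrs v).countP fun u => (A.sent nw c v u).isSome

/-- The total number of messages sent in the whole execution (possibly infinite). -/
def messages (nw : Network V N) (ω : V × ℕ → ℕ) : ℝ≥0∞ :=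
  ∑' r, (A.roundMessages nw (A.config nw ω r) : ℝ≥0∞)

/-- The execution computes a maximal independent set: from some round on, every node has a fixed
decision, and the nodes that decided to be in form a maximal independent set. -/
def ComputesMIS (nw : Network V N) (ω : V × ℕ → ℕ) : Prop :=
  ∃ S : Set V, Maximal (fun T : Set V => nw.graph.IsIndepSet T) S ∧
    ∃ d : V → Bool, (∀ v, d v = true ↔ v ∈ S) ∧
      ∀ᶠ r in atTop, ∀ v, A.output (A.config nw ω r v).1 = some (d v)

/-- The law of the seeds: independent over all nodes and all rounds, each distributed as `coin`. -/
def coinMeasure (V : Type) : Measure (V × ℕ → ℕ) :=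
  Measure.infinitePi fun _ => A.coin.toMeasure

/-- The probability that the execution on `nw` does not compute a maximal independent set. -/
def errorProb (nw : Network V N) : ℝ≥0∞ :=
  A.coinMeasure V {ω | ¬ A.ComputesMIS nw ω}

/-- The expected number of messages sent in the execution on `nw`. -/
def expectedMessages (nw : Network V N) : ℝ≥0∞ :=
  ∫⁻ ω, A.messages nw ω ∂(A.coinMeasure V)

end Algorithm

end Congest

end

/-!
The hard network consists of `m` disjoint copies (gadgets) of `K_{t,t}`, and isolated nodes. A gadget
is cut into blocks, each with one node `x` of one side and one node `y` of the other, which have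
consecutive IDs. The only maximal independent sets of a gadget are its two sides.

To cross two blocks `a ≠ b` of a gadget is to replace the edges `{x_a, y_b}` and `{x_b, y_a}` by
`{x_a, x_b}` and `{y_a, y_b}`. Afterwards both sides contain an edge, so neither of them is a
solution any more (`not_isMISOn_crossed`). A comparison-based algorithm notices the crossing only if
a message passes between the two blocks, or a message from or to one of them carries an ID from the
other: otherwise all comparisons come out the same, because in the order of the IDs known to `x_a`
the node `x_b` takes the place of `y_b` (`similar_config`, `isRewiring_crossedNetwork`). Hence,
with the same seeds, an execution that solves the gadget before and after crossing touches the pair of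
blocks (`solvedOn_inter_subset_touches`). With at most `κ` IDs per message, a message touches at most
`2 + 4κ` pairs (`card_touches_le`), so if few messages are expected, then most gadgets have a pair
that is touched with small probability `δ`. The probabilities of solving the gadget before and after
crossing this pair then add up to at most `1 + δ`.

One gadget rules out error probabilities below roughly `1 / 2`. For error probabilities close to `1`,
all gadgets are crossed at once: coins are private, so the gadgets are solved independently
(`one_sub_errorProb_le_prod`), and the success probabilities `∏ a_g` before and `∏ b_g` after crossing
satisfy `∏ a_g b_g ≤ ∏ ((1 + δ_g) / 2) ^ 2`. This is smaller than `(1 - ε) ^ 2` for some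
`m = O(1 + log (1 / (1 - ε)))` (`prod_lt_of_add_le`). The price is that only about
`m * (n / m) ^ 2 = n ^ 2 / m` pairs of blocks share a gadget, and this is still at least of order
`(1 - ε) * n ^ 2` (`mul_ceil_le`).
-/

namespace Congest

/-! ### Ports and lists of IDs -/

section Ports

variable {V : Type} [Fintype V] {N : ℕ}

lemma Network.mem_nbrs {nw : Network V N} {u v : V} : u ∈ nw.nbrs v ↔ nw.graph.Adj v u := by
  simp [Network.nbrs]

lemma Network.pairwise_nbrs (nw : Network V N) (v : V) :
    (nw.nbrs v).Pairwise fun a b => nw.id a < nw.id b := by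
  let := LinearOrder.lift' nw.id nw.id.injective
  exact (Finset.sortedLT_sort _).pairwise

lemma Network.nodup_nbrs (nw : Network V N) (v : V) : (nw.nbrs v).Nodup :=
  (nw.pairwise_nbrs v).imp fun h e => by simp [e] at h

/-- The port list is the only list of the neighbours that is sorted by ID. -/
lemma Network.nbrs_eq_of_pairwise {nw : Network V N} {v : V} {l : List V}
    (hmem : ∀ u, u ∈ l ↔ nw.graph.Adj v u) (hl : l.Pairwise fun a b => nw.id a < nw.id b) :
    nw.nbrs v = l := by
  have hnd : l.Nodup := hl.imp fun h e => by simp [e] at h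
  refine List.Perm.eq_of_pairwise (fun a b _ _ h h' => (lt_asymm h h').elim)
    (nw.pairwise_nbrs v) hl ((List.perm_ext_iff_of_nodup (nw.nodup_nbrs v) hnd).2 fun u => ?_)
  rw [hmem, Network.mem_nbrs]

end Ports

section ListLemmas

variable {α β : Type} {N : ℕ}

lemma cmpTable_map_congr {f g : α → Fin N} {l : List α}
    (h : ∀ x ∈ l, ∀ y ∈ l, compare (f x) (f y) = compare (g x) (g y)) :
    cmpTable (l.map f) = cmpTable (l.map g) := by
  simp only [cmpTable, List.map_map]
  exact List.map_congr_left fun x hx => List.map_congr_left fun y hy => h x hx y hy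

lemma filterMap_getElem?_map (f : α → β) (l : List α) (ks : List ℕ) :
    (ks.filterMap fun k => (l.map f)[k]?) = (ks.filterMap fun k => l[k]?).map f := by
  simp [List.map_filterMap]

lemma exists_map_eq {f : α → β} {p : α → Prop} {l : List β} (h : ∀ b ∈ l, ∃ a, f a = b ∧ p a) :
    ∃ k : List α, k.map f = l ∧ ∀ a ∈ k, p a := by
  induction l with
  | nil => exact ⟨[], rfl, by simp⟩
  | cons b l ih =>
    obtain ⟨a, ha, hp⟩ := h b (by simp)
    obtain ⟨k, hk, hkp⟩ := ih fun b hb => h b (by simp [hb])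
    exact ⟨a :: k, by simp [ha, hk], by simpa using ⟨hp, hkp⟩⟩

lemma idxOf_map_of_involutive [DecidableEq α] {s : α → α} (hs : Function.Involutive s)
    (l : List α) (z : α) : (l.map s).idxOf z = l.idxOf (s z) := by
  induction l with
  | nil => simp
  | cons a l ih => simp [List.idxOf_cons, ih, hs.eq_iff, beq_eq_decide]

end ListLemmas

/-! ### Rewirings that comparisons do not detect -/

section Rewiring

variable {V : Type} {N : ℕ}

/-- A rewiring of `nw` into `nw'` with the same IDs: to node `w`, the node `x` of `nw` corresponds
to the node `σ w x` of `nw'`. Each `σ w` is an involution, matches the ports of `w` in both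
networks, and preserves the order of the IDs as far as `w` may know them: the neighbours of `w`
and the nodes fixed by `σ w`. -/
structure IsRewiring (nw nw' : Network V N) (σ : V → V → V) : Prop where
  id_eq : nw'.id = nw.id
  involutive : ∀ w, Function.Involutive (σ w)
  self : ∀ w, σ w w = w
  adj_iff : ∀ w x, nw'.graph.Adj w (σ w x) ↔ nw.graph.Adj w x
  lt_iff : ∀ w x y, nw.graph.Adj w x ∨ σ w x = x → nw.graph.Adj w y ∨ σ w y = y →
    (nw.id (σ w x) < nw.id (σ w y) ↔ nw.id x < nw.id y)

/-- No edge of the network leaves the node set `B`. -/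
def Network.Closed (nw : Network V N) (B : Set V) : Prop :=
  ∀ u ∈ B, ∀ v, nw.graph.Adj u v → v ∈ B

lemma IsRewiring.compare_eq {nw nw' : Network V N} {σ : V → V → V}
    (h : IsRewiring nw nw' σ) {w x y : V}
    (hx : nw.graph.Adj w x ∨ σ w x = x)
    (hy : nw.graph.Adj w y ∨ σ w y = y) :
    compare (nw.id (σ w x)) (nw.id (σ w y)) = compare (nw.id x) (nw.id y) := by
  have h1 := h.lt_iff w x y hx hy
  rcases lt_trichotomy (nw.id x) (nw.id y) with hlt | heq | hgt
  · rw [compare_lt_iff_lt.2 hlt, compare_lt_iff_lt.2 (h1.2 hlt)]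
  · rw [nw.id.injective heq, compare_eq_iff_eq.2 rfl, compare_eq_iff_eq.2 rfl]
  · rw [compare_gt_iff_gt.2 hgt, compare_gt_iff_gt.2 ((h.lt_iff w y x hy hx).2 hgt)]

variable [Fintype V]

namespace IsRewiring

variable {nw nw' : Network V N} {σ : V → V → V}

lemma nbrs_eq (h : IsRewiring nw nw' σ) (w : V) : nw'.nbrs w = (nw.nbrs w).map (σ w) := by
  refine Network.nbrs_eq_of_pairwise (fun u => ?_) ?_
  · rw [← h.involutive w u, List.mem_map_of_injective (h.involutive w).injective, h.adj_iff,
      Network.mem_nbrs]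
  · rw [List.pairwise_map]
    refine (nw.pairwise_nbrs w).imp_of_mem fun {a b} ha hb hab => ?_
    rw [h.id_eq, h.lt_iff _ _ _ (.inl (Network.mem_nbrs.1 ha)) (.inl (Network.mem_nbrs.1 hb))]
    exact hab

end IsRewiring

namespace Algorithm

variable (A : Algorithm)

/-- In the round that starts from the configuration `c`, the part `B` of the network does not
touch the rewiring `σ`: no message travels between two nodes of which `σ` moves one as seen from
the other, and no message carries an ID that `σ` moves as seen from its sender or its receiver. -/
def Quiet (nw : Network V N) (σ : V → V → V) (B : Set V) (c : A.Config V N) : Prop :=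
  ∀ u ∈ B, ∀ v, nw.graph.Adj u v → ∀ m, A.sent nw c u v = some m →
    σ u v = v ∧ σ v u = u ∧ ∀ x, nw.id x ∈ m.ids → σ u x = x ∧ σ v x = x

/-- Node `w` is in the same state in both configurations, and its ID-type variables correspond to
each other under `σ w`. -/
def Similar (nw : Network V N) (σ : V → V → V) (c c' : A.Config V N) (w : V) : Prop :=
  (c' w).1 = (c w).1 ∧ ∃ L : List V, (c w).2 = L.map nw.id ∧
    (c' w).2 = L.map (fun x => nw.id (σ w x)) ∧ ∀ x ∈ L, nw.graph.Adj w x ∨ σ w x = x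

variable {A} {nw nw' : Network V N} {σ : V → V → V} {B : Set V} {c c' : A.Config V N}

/-- Port by port, a node sends messages that correspond to each other under `σ u`; the port of the
neighbour `z` in `nw'` is that of `σ u z` in `nw`. -/
lemma sent_of_similar (h : IsRewiring nw nw' σ) {u z : V} (hs : A.Similar nw σ c c' u) :
    ∃ o : Option (Message V), A.sent nw c u (σ u z) = o.map (fun m => ⟨m.bits, m.ids.map nw.id⟩) ∧
      A.sent nw' c' u z = o.map fun m => ⟨m.bits, m.ids.map fun x => nw.id (σ u x)⟩ := by
  classical
  obtain ⟨hst, L, hL, hL', -⟩ := hs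
  refine ⟨(A.send (c u).1 ((nw.nbrs u).idxOf (σ u z))).map
    fun m => ⟨m.bits, m.ids.filterMap fun k => L[k]?⟩, ?_, ?_⟩
  · simp only [sent, hL, Option.map_map, filterMap_getElem?_map]
    congr!
  · have hi : (nw'.nbrs u).idxOf z = (nw.nbrs u).idxOf (σ u z) := by
      rw [h.nbrs_eq, idxOf_map_of_involutive (h.involutive u)]
    simp only [sent, hL', hst, Option.map_map, filterMap_getElem?_map]
    rw [← hi]
    congr!

/-- In a quiet round, the message that `w` receives through a given port is the same in both
networks, even where the neighbour behind the port is not. -/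
lemma sent_rewired (h : IsRewiring nw nw' σ) (hB : nw.Closed B) (hB' : nw'.Closed B)
    (hs : ∀ w ∈ B, A.Similar nw σ c c' w) (hq : A.Quiet nw σ B c) {w x : V} (hw : w ∈ B)
    (hx : nw.graph.Adj w x) : A.sent nw' c' (σ w x) w = A.sent nw c x w := by
  have hxB : x ∈ B := hB w hw x hx
  by_cases hfix : σ w x = x ∧ σ x w = w
  · rw [hfix.1]
    obtain ⟨o, ho, ho'⟩ := sent_of_similar (z := w) h (hs x hxB)
    rw [hfix.2] at ho
    cases o with
    | none => rw [ho, ho']; rfl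
    | some m =>
      have hfixm := (hq x hxB w hx.symm _ ho).2.2
      rw [ho, ho']
      simp only [Option.map_some, Option.some.injEq, Message.mk.injEq, true_and]
      refine List.map_congr_left fun y hy => ?_
      rw [(hfixm y (List.mem_map_of_mem hy)).1]
  · -- Both messages are absent: each of them would touch the rewiring.
    have h1 : A.sent nw c x w = none := by
      by_contra hne
      obtain ⟨m, hm⟩ := Option.ne_none_iff_exists'.1 hne
      obtain ⟨e1, e2, -⟩ := hq x hxB w hx.symm m hm
      exact hfix ⟨e2, e1⟩
    have hadj : nw'.graph.Adj w (σ w x) := (h.adj_iff w x).2 hx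
    have hx'B : σ w x ∈ B := hB' w hw _ hadj
    rw [h1]
    by_contra hne
    obtain ⟨m', hm'⟩ := Option.ne_none_iff_exists'.1 hne
    obtain ⟨o, ho, ho'⟩ := sent_of_similar (z := w) h (hs _ hx'B)
    cases o with
    | none => simp [ho'] at hm'
    | some m =>
      have hadj2 : nw.graph.Adj (σ w x) (σ (σ w x) w) := by
        rw [← h.adj_iff, h.involutive]; exact hadj.symm
      obtain ⟨e1, e2, -⟩ := hq _ hx'B _ hadj2 _ ho
      rw [h.involutive] at e1
      rw [← e1, h.involutive] at e2
      exact hfix ⟨e2.symm, by rw [← e2] at e1; exact e1.symm⟩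

lemma inbox_rewired (h : IsRewiring nw nw' σ) (hB : nw.Closed B) (hB' : nw'.Closed B)
    (hs : ∀ w ∈ B, A.Similar nw σ c c' w) (hq : A.Quiet nw σ B c) {w : V} (hw : w ∈ B) :
    A.inbox nw' c' w = A.inbox nw c w := by
  rw [inbox, inbox, h.nbrs_eq, List.map_map]
  exact List.map_congr_left fun x hx =>
    sent_rewired h hB hB' hs hq hw (Network.mem_nbrs.1 hx)

lemma Similar.round (h : IsRewiring nw nw' σ) (hB : nw.Closed B) (hB' : nw'.Closed B)
    (hs : ∀ w ∈ B, A.Similar nw σ c c' w) (hq : A.Quiet nw σ B c) (seed : V → ℕ) {w : V}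
    (hw : w ∈ B) : A.Similar nw σ (A.round nw c seed) (A.round nw' c' seed) w := by
  obtain ⟨hst, L, hL, hL', hLk⟩ := hs w hw
  have hin := inbox_rewired h hB hB' hs hq hw
  -- The received IDs are IDs of nodes that `σ w` fixes.
  obtain ⟨R, hR, hRfix⟩ : ∃ R : List V, R.map nw.id =
      ((A.inbox nw c w).flatMap fun o => o.elim [] Message.ids) ∧ ∀ x ∈ R, σ w x = x := by
    refine exists_map_eq fun a ha => ?_
    simp only [inbox, List.flatMap_map, List.mem_flatMap] at ha
    obtain ⟨u, hu, ha⟩ := ha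
    have hadj := Network.mem_nbrs.1 hu
    have huB := hB w hw u hadj
    cases hm : A.sent nw c u w with
    | none => simp [hm] at ha
    | some m =>
      rw [hm] at ha
      obtain ⟨-, L', hu', -⟩ := hs u huB
      have ha' : ∃ x, nw.id x = a := by
        simp only [sent, Option.map_eq_some_iff] at hm
        obtain ⟨m0, -, rfl⟩ := hm
        simp only [Option.elim, hu', filterMap_getElem?_map, List.mem_map] at ha
        obtain ⟨x, -, hx⟩ := ha
        exact ⟨x, hx⟩
      obtain ⟨x, rfl⟩ := ha'
      exact ⟨x, rfl, ((hq u huB w hadj.symm m hm).2.2 x ha).2⟩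
  have hids : (A.round nw c seed w).2 = (L ++ R).map nw.id := by
    simp only [Algorithm.round, List.map_append, hL, hR]
  have hids' : (A.round nw' c' seed w).2 = (L ++ R).map fun x => nw.id (σ w x) := by
    simp only [Algorithm.round, List.map_append, hL', hin, ← hR]
    congr 1
    exact List.map_congr_left fun x hx => by rw [hRfix x hx]
  have hknown : ∀ x ∈ L ++ R, nw.graph.Adj w x ∨ σ w x = x := fun x hx =>
    (List.mem_append.1 hx).elim (hLk x) fun hx => .inr (hRfix x hx)
  refine ⟨?_, L ++ R, hids, hids', hknown⟩
  change A.step _ (cmpTable (A.round nw' c' seed w).2) _ _ =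
    A.step _ (cmpTable (A.round nw c seed w).2) _ _
  rw [hids, hids', hst, hin, cmpTable_map_congr fun x hx y hy =>
    h.compare_eq (hknown x hx) (hknown y hy)]

/-- As long as a closed part of the network does not touch the rewiring, its nodes cannot tell the
two networks apart. -/
lemma similar_config (h : IsRewiring nw nw' σ) (hB : nw.Closed B) (hB' : nw'.Closed B)
    (ω : V × ℕ → ℕ) (r : ℕ) (hq : ∀ s < r, A.Quiet nw σ B (A.config nw ω s)) :
    ∀ w ∈ B, A.Similar nw σ (A.config nw ω r) (A.config nw' ω r) w := by
  induction r with
  | zero =>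
    intro w _
    have hids : nw.initIds w = (w :: nw.nbrs w).map nw.id := rfl
    have hids' : nw'.initIds w = (w :: nw.nbrs w).map fun x => nw.id (σ w x) := by
      simp [Network.initIds, h.id_eq, h.nbrs_eq, h.self]
    have hknown : ∀ x ∈ w :: nw.nbrs w, nw.graph.Adj w x ∨ σ w x = x := by
      intro x hx
      rcases List.mem_cons.1 hx with rfl | hx
      · exact .inr (h.self x)
      · exact .inl (Network.mem_nbrs.1 hx)
    refine ⟨?_, _, hids, hids', hknown⟩
    change A.init (cmpTable (nw'.initIds w)) _ = A.init (cmpTable (nw.initIds w)) _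
    rw [hids, hids', cmpTable_map_congr fun x hx y hy => h.compare_eq (hknown x hx) (hknown y hy)]
  | succ r ih =>
    exact fun w hw => Similar.round h hB hB' (ih fun s hs => hq s (hs.trans (Nat.lt_succ_self r)))
      (hq r (Nat.lt_succ_self r)) _ hw

end Algorithm

end Rewiring

/-! ### Independence of events that depend on disjoint sets of coordinates -/

section Independence

variable {ι : Type}

/-- The event `E` depends only on the coordinates in `S`. -/
def EventDependsOn (E : Set (ι → ℕ)) (S : Set ι) : Prop :=
  ∀ ω ω' : ι → ℕ, (∀ i ∈ S, ω i = ω' i) → (ω ∈ E ↔ ω' ∈ E)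

lemma EventDependsOn.measurableSet_iSup_comap {E : Set (ι → ℕ)} {S : Set ι}
    (h : EventDependsOn E S) (hE : MeasurableSet E) :
    MeasurableSet[⨆ i ∈ S, (inferInstance : MeasurableSpace ℕ).comap fun ω : ι → ℕ => ω i] E := by
  classical
  let f : (ι → ℕ) → ι → ℕ := fun ω i => if i ∈ S then ω i else 0
  have hEf : f ⁻¹' E = E := by
    ext ω
    exact h _ _ fun i hi => if_pos hi
  have hf : Measurable[⨆ i ∈ S, (inferInstance : MeasurableSpace ℕ).comap
      fun ω : ι → ℕ => ω i] f := by
    refine @measurable_pi_lambda _ _ _ (_) _ _ fun i => ?_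
    by_cases hi : i ∈ S
    · simp only [f, if_pos hi]
      exact measurable_iff_comap_le.2 (le_iSup₂_of_le i hi le_rfl)
    · simp only [f, if_neg hi]
      exact @measurable_const _ _ _ (_) _
  rw [← hEf]
  exact hf hE

lemma infinitePi_inter_of_dependsOn (ν : Measure ℕ) [IsProbabilityMeasure ν]
    {E F : Set (ι → ℕ)} {S T : Set ι} (hE : MeasurableSet E) (hF : MeasurableSet F)
    (hES : EventDependsOn E S) (hFT : EventDependsOn F T) (hST : Disjoint S T) :
    Measure.infinitePi (fun _ : ι => ν) (E ∩ F) =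
      Measure.infinitePi (fun _ : ι => ν) E * Measure.infinitePi (fun _ : ι => ν) F := by
  have hind := ProbabilityTheory.iIndepFun_infinitePi (P := fun _ : ι => ν)
    (X := fun _ (x : ℕ) => x) fun _ => measurable_id
  have := ProbabilityTheory.indep_iSup_of_disjoint
    (fun i => (measurable_pi_apply i).comap_le) hind.iIndep hST
  exact ProbabilityTheory.Indep_iff _ _ _ |>.1 this _ _
    (hES.measurableSet_iSup_comap hE) (hFT.measurableSet_iSup_comap hF)

lemma infinitePi_biInter_of_dependsOn (ν : Measure ℕ) [IsProbabilityMeasure ν] {κ : Type}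
    {E : κ → Set (ι → ℕ)} {S : κ → Set ι} (hE : ∀ k, MeasurableSet (E k))
    (hES : ∀ k, EventDependsOn (E k) (S k)) (hS : Pairwise fun k l => Disjoint (S k) (S l))
    (s : Finset κ) :
    Measure.infinitePi (fun _ : ι => ν) (⋂ k ∈ s, E k) =
      ∏ k ∈ s, Measure.infinitePi (fun _ : ι => ν) (E k) := by
  classical
  induction s using Finset.induction_on with
  | empty => simp
  | insert a s ha ih =>
    rw [Finset.set_biInter_insert, Finset.prod_insert ha, ← ih]
    refine infinitePi_inter_of_dependsOn ν (T := ⋃ k ∈ s, S k) (hE a)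
      (s.measurableSet_biInter fun k _ => hE k) (hES a) ?_ ?_
    · intro ω ω' h
      simp only [Set.mem_iInter]
      exact forall₂_congr fun k hk => hES k _ _ fun i hi => h i (Set.mem_biUnion hk hi)
    · refine Set.disjoint_iUnion₂_right.2 fun k hk => hS ?_
      rintro rfl
      exact ha hk

end Independence

/-! ### Maximal independent sets and messages as events -/

section MIS

variable {V : Type}

/-- The indicator `d` of a node set is that of a maximal independent set of the subgraph of `G`
induced by `B`. -/
def IsMISOn (G : SimpleGraph V) (B : Set V) (d : V → Bool) : Prop :=
  (∀ u ∈ B, ∀ v ∈ B, G.Adj u v → ¬(d u = true ∧ d v = true)) ∧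
    ∀ u ∈ B, d u = false → ∃ v ∈ B, G.Adj u v ∧ d v = true

lemma isMISOn_of_maximal {N : ℕ} {nw : Network V N} {B : Set V} (hB : nw.Closed B) {S : Set V}
    (hS : Maximal (fun T : Set V => nw.graph.IsIndepSet T) S) {d : V → Bool}
    (hd : ∀ v, d v = true ↔ v ∈ S) : IsMISOn nw.graph B d := by
  refine ⟨fun u _ v _ huv h => hS.prop ((hd u).1 h.1) ((hd v).1 h.2) huv.ne huv, fun u hu hdu => ?_⟩
  have huS : u ∉ S := fun h => by simp [(hd u).2 h] at hdu
  by_contra hno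
  push Not at hno
  refine huS (hS.le_of_ge (y := insert u S) ?_ (Set.subset_insert u S) (Set.mem_insert u S))
  have : Std.Symm fun a b => ¬nw.graph.Adj a b := ⟨fun _ _ h e => h e.symm⟩
  refine Set.pairwise_insert_of_symm.2
    ⟨hS.prop, fun v hv _ huv => hno v (hB u hu v huv) huv ((hd v).2 hv)⟩

end MIS

section Events

variable {V : Type} [Fintype V] {N : ℕ}

namespace Algorithm

variable (A : Algorithm) (nw : Network V N)

instance : IsProbabilityMeasure (A.coinMeasure V) := by
  unfold coinMeasure; infer_instance

variable {A} {nw}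

/-- The configuration of a closed part of the network is a function of the seeds drawn there. -/
lemma config_congr {B : Set V} (hB : nw.Closed B) {ω ω' : V × ℕ → ℕ} {r : ℕ}
    (h : ∀ v ∈ B, ∀ s ≤ r, ω (v, s) = ω' (v, s)) :
    ∀ v ∈ B, A.config nw ω r v = A.config nw ω' r v := by
  induction r with
  | zero =>
    intro v hv
    simp only [config, h v hv 0 le_rfl]
  | succ r ih =>
    intro v hv
    have ih' := ih fun v hv s hs => h v hv s (hs.trans (Nat.le_succ r))
    have hin : A.inbox nw (A.config nw ω r) v = A.inbox nw (A.config nw ω' r) v := by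
      refine List.map_congr_left fun u hu => ?_
      simp only [sent, ih' u (hB v hv u (Network.mem_nbrs.1 hu))]
    simp only [config, Algorithm.round, hin, ih' v hv, h v hv (r + 1) le_rfl]

/-- Only finitely many seeds, with countably many values, influence the configuration in a given
round, so every event about it is measurable. -/
lemma measurableSet_config (r : ℕ) (Q : A.Config V N → Prop) :
    MeasurableSet {ω | Q (A.config nw ω r)} := by
  classical
  let F : Finset (V × ℕ) := Finset.univ ×ˢ Finset.range (r + 1)
  let ext : (F → ℕ) → V × ℕ → ℕ := fun f p => if hp : p ∈ F then f ⟨p, hp⟩ else 0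
  have : {ω | Q (A.config nw ω r)} = F.restrict ⁻¹' {f | Q (A.config nw (ext f) r)} := by
    ext ω
    have hc : A.config nw ω r = A.config nw (ext (F.restrict ω)) r := by
      funext v
      refine config_congr (B := Set.univ) (fun _ _ _ _ => trivial) (fun v _ s hs => ?_) v trivial
      have hp : (v, s) ∈ F := by simp [F]; omega
      simp [ext, hp]
    simp only [Set.mem_ofPred_eq, Set.mem_preimage]
    rw [hc]
  rw [this]
  exact Finset.measurable_restrict F (.of_discrete)

variable (A nw) in
/-- The event that the outputs of the nodes in `B` are eventually fixed and form a maximal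
independent set of the part `B` of the network. -/
def solvedOn (B : Set V) : Set (V × ℕ → ℕ) :=
  {ω | ∃ d : V → Bool, IsMISOn nw.graph B d ∧
    ∀ᶠ r in atTop, ∀ v ∈ B, A.output (A.config nw ω r v).1 = some (d v)}

lemma measurableSet_solvedOn (B : Set V) : MeasurableSet (A.solvedOn nw B) := by
  simp only [solvedOn, Set.ofPred_exists]
  refine MeasurableSet.iUnion fun d => ?_
  simp only [Set.ofPred_and, eventually_atTop, Set.ofPred_exists, Set.ofPred_forall]
  refine (MeasurableSet.const _).inter (.iUnion fun r => .iInter fun s => .iInter fun _ => ?_)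
  simp only [← Set.ofPred_forall]
  exact measurableSet_config s fun c => ∀ v ∈ B, A.output (c v).1 = some (d v)

lemma eventDependsOn_solvedOn {B : Set V} (hB : nw.Closed B) :
    EventDependsOn (A.solvedOn nw B) {p | p.1 ∈ B} := by
  intro ω ω' h
  simp only [solvedOn, Set.mem_ofPred_eq]
  refine exists_congr fun d => and_congr_right fun _ => ?_
  refine Filter.eventually_congr (.of_forall fun r => forall₂_congr fun v hv => ?_)
  rw [config_congr hB (fun v hv s _ => h (v, s) hv) v hv]

/-- As the coins are private, disjoint closed parts of the network are solved independently: the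
product of their success probabilities bounds that of the whole network. -/
lemma one_sub_errorProb_le_prod {κ : Type} {B : κ → Set V} (hB : ∀ k, nw.Closed (B k))
    (hdisj : Pairwise fun k l => Disjoint (B k) (B l)) (s : Finset κ) :
    1 - A.errorProb nw ≤ ∏ k ∈ s, A.coinMeasure V (A.solvedOn nw (B k)) := by
  have hprod := infinitePi_biInter_of_dependsOn A.coin.toMeasure
    (E := fun k => A.solvedOn nw (B k)) (S := fun k => {p : V × ℕ | p.1 ∈ B k})
    (fun k => measurableSet_solvedOn (B k)) (fun k => eventDependsOn_solvedOn (hB k))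
    (fun k l hkl => Set.disjoint_left.2 fun p hp hp' => Set.disjoint_left.1 (hdisj hkl) hp hp') s
  change A.coinMeasure V _ = _ at hprod
  rw [coinMeasure] at *
  rw [← hprod, tsub_le_iff_right, errorProb, ← coinMeasure,
    ← measure_univ (μ := A.coinMeasure V)]
  refine (measure_mono fun ω _ => ?_).trans (measure_union_le _ _)
  by_cases hω : A.ComputesMIS nw ω
  · left
    obtain ⟨S, hS, d, hd, hout⟩ := hω
    exact Set.mem_iInter₂.2 fun k _ =>
      ⟨d, isMISOn_of_maximal (hB k) hS hd, hout.mono fun r hr v _ => hr v⟩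
  · exact .inr hω

/-- If in every round the number of properties `T p` that hold is at most `K` times the number of
messages, then the probabilities that `T p` ever holds add up to at most `K` times the expected
number of messages. -/
lemma sum_measure_exists_le {κ : Type} (s : Finset κ) (T : κ → A.Config V N → Prop) (K : ℕ)
    (hT : ∀ c, ∀ s' ⊆ s, (∀ p ∈ s', T p c) → s'.card ≤ K * A.roundMessages nw c) :
    ∑ p ∈ s, A.coinMeasure V {ω | ∃ r, T p (A.config nw ω r)} ≤ K * A.expectedMessages nw := by
  classical
  have hmeas : ∀ p r, MeasurableSet {ω | T p (A.config nw ω r)} := fun p r =>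
    measurableSet_config r (T p)
  have hmsg : ∀ r, Measurable fun ω => (A.roundMessages nw (A.config nw ω r) : ℝ≥0∞) :=
    fun r S _ => measurableSet_config r fun c => (A.roundMessages nw c : ℝ≥0∞) ∈ S
  calc ∑ p ∈ s, A.coinMeasure V {ω | ∃ r, T p (A.config nw ω r)}
      ≤ ∑ p ∈ s, ∑' r, A.coinMeasure V {ω | T p (A.config nw ω r)} := by
        refine Finset.sum_le_sum fun p _ => ?_
        rw [Set.ofPred_exists]
        exact measure_iUnion_le _
    _ = ∑' r, ∑ p ∈ s, A.coinMeasure V {ω | T p (A.config nw ω r)} :=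
        (Summable.tsum_finsetSum fun _ _ => ENNReal.summable).symm
    _ ≤ ∑' r, K * ∫⁻ ω, A.roundMessages nw (A.config nw ω r) ∂A.coinMeasure V := by
        refine ENNReal.tsum_le_tsum fun r => ?_
        rw [← lintegral_const_mul _ (hmsg r)]
        simp_rw [← lintegral_indicator_one (hmeas _ r)]
        rw [← lintegral_finsetSum _ fun p _ => measurable_one.indicator (hmeas p r)]
        refine lintegral_mono fun ω => ?_
        have := hT (A.config nw ω r) (s.filter fun p => T p (A.config nw ω r))
          (Finset.filter_subset _ _) fun p hp => (Finset.mem_filter.1 hp).2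
        simp only [Set.indicator_apply, Set.mem_ofPred_eq, Pi.one_apply, Finset.sum_boole]
        exact_mod_cast this
    _ = K * A.expectedMessages nw := by
        rw [ENNReal.tsum_mul_left, expectedMessages]
        simp only [messages]
        rw [lintegral_tsum fun r => (hmsg r).aemeasurable]

end Algorithm

end Events

/-! ### Bipartite gadgets and their crossing -/

section Construction

variable {n : ℕ}

/-- The other node of the block `{2 * a, 2 * a + 1}` of `v`, or `v` itself if that node does not
exist. -/
def partner (v : Fin n) : Fin n :=
  if v.val % 2 = 0 then if h : v.val + 1 < n then ⟨v.val + 1, h⟩ else v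
  else ⟨v.val - 1, (Nat.sub_le _ _).trans_lt v.isLt⟩

lemma partner_involutive : Function.Involutive (partner (n := n)) := by
  intro v
  unfold partner
  split_ifs with h1 h2 h3 h4 h5 <;> simp_all [Fin.ext_iff] <;> omega

lemma partner_div_two (v : Fin n) : (partner v).val / 2 = v.val / 2 := by
  unfold partner
  split_ifs <;> simp <;> omega

lemma partner_val {v : Fin n} (h : 2 * (v.val / 2) + 1 < n) :
    (v.val % 2 = 0 ∧ (partner v).val = v.val + 1) ∨
      (v.val % 2 = 1 ∧ (partner v).val + 1 = v.val) := by
  unfold partner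
  split_ifs <;> simp <;> omega

/-- `m` disjoint copies of the complete bipartite graph `K_{t,t}`, and isolated nodes. Node `v` lies
in the block `v / 2`, and the blocks `g * t, …, g * t + t - 1` form the gadget `g`, in which the even
nodes are joined to the odd nodes. -/
def gadgetGraph (n t m : ℕ) : SimpleGraph (Fin n) where
  Adj u v := u.val / 2 / t = v.val / 2 / t ∧ u.val / 2 / t < m ∧ u.val % 2 ≠ v.val % 2
  symm := ⟨fun _ _ h => ⟨h.1.symm, h.1 ▸ h.2.1, h.2.2.symm⟩⟩
  loopless := ⟨fun _ h => h.2.2 rfl⟩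

/-- The blocks of `u` and `v` form a pair in `P`, in either order. -/
def Crossed (P : Set (ℕ × ℕ)) (u v : Fin n) : Prop :=
  (u.val / 2, v.val / 2) ∈ P ∨ (v.val / 2, u.val / 2) ∈ P

lemma Crossed.symm {P : Set (ℕ × ℕ)} {u v : Fin n} (h : Crossed P u v) : Crossed P v u := Or.symm h

lemma crossed_congr {P : Set (ℕ × ℕ)} {u v u' v' : Fin n} (hu : u'.val / 2 = u.val / 2)
    (hv : v'.val / 2 = v.val / 2) : Crossed P u' v' ↔ Crossed P u v := by
  simp only [Crossed, hu, hv]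

open Classical in
/-- Seen from `u`, the two nodes of each block that `P` pairs with the block of `u` are exchanged. -/
noncomputable def cross (P : Set (ℕ × ℕ)) (u v : Fin n) : Fin n :=
  if Crossed P u v then partner v else v

lemma cross_div_two (P : Set (ℕ × ℕ)) (u v : Fin n) : (cross P u v).val / 2 = v.val / 2 := by
  unfold cross
  split_ifs
  · exact partner_div_two v
  · rfl

lemma cross_involutive (P : Set (ℕ × ℕ)) (u : Fin n) : Function.Involutive (cross P u) := by
  intro v
  by_cases h : Crossed P u v
  · have h' : Crossed P u (partner v) := (crossed_congr rfl (partner_div_two v)).2 h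
    have he : cross P u v = partner v := if_pos h
    rw [he, cross, if_pos h', partner_involutive v]
  · have he : cross P u v = v := if_neg h
    rw [he, he]

/-- The pairs in `P` consist of two different blocks of the same gadget. -/
def IsPairing (t m : ℕ) (P : Set (ℕ × ℕ)) : Prop :=
  ∀ p ∈ P, p.1 ≠ p.2 ∧ p.1 / t = p.2 / t ∧ p.1 / t < m

variable {t m : ℕ} {P : Set (ℕ × ℕ)}

lemma IsPairing.of_crossed (hP : IsPairing t m P) {u v : Fin n} (h : Crossed P u v) :
    u.val / 2 ≠ v.val / 2 ∧ u.val / 2 / t = v.val / 2 / t ∧ u.val / 2 / t < m := by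
  rcases h with h | h
  · exact hP _ h
  · obtain ⟨h1, h2, h3⟩ := hP _ h
    exact ⟨h1.symm, h2.symm, h2 ▸ h3⟩

lemma IsPairing.cross_self (hP : IsPairing t m P) (u : Fin n) : cross P u u = u :=
  if_neg fun h => (hP.of_crossed h).1 rfl

/-- All nodes of the block `a` of a gadget exist. -/
lemma block_lt (hn : 2 * (t * m) ≤ n) {a : ℕ} (ha : a / t < m) (ht : 0 < t) : 2 * a + 1 < n := by
  have := (Nat.div_lt_iff_lt_mul ht).1 ha
  rw [mul_comm] at this
  omega

/-- The gadgets after crossing: for `(a, b) ∈ P`, the edges `{2a, 2b+1}` and `{2b, 2a+1}` are replaced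
by `{2a, 2b}` and `{2a+1, 2b+1}`. -/
def crossedGraph (hn : 2 * (t * m) ≤ n) (ht : 0 < t) (hP : IsPairing t m P) :
    SimpleGraph (Fin n) where
  Adj u v := (gadgetGraph n t m).Adj u (cross P u v)
  symm := ⟨by
    intro u v h
    by_cases hc : Crossed P u v
    · have hc' := hc.symm
      have hu := partner_val (block_lt hn (hP.of_crossed hc).2.2 ht)
      have hv := partner_val (block_lt hn (hP.of_crossed hc').2.2 ht)
      have hub := partner_div_two u
      have hvb := partner_div_two v
      simp only [cross, if_pos hc, if_pos hc', gadgetGraph] at h ⊢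
      rw [hvb] at h
      rw [hub]
      exact ⟨h.1.symm, h.1 ▸ h.2.1, by omega⟩
    · have hc' : ¬Crossed P v u := fun h => hc h.symm
      simp only [cross, if_neg hc, if_neg hc'] at h ⊢
      exact h.symm⟩
  loopless := ⟨fun u h => by
    rw [hP.cross_self] at h
    exact h.ne rfl⟩

/-- The nodes of the gadget `g`. -/
def gadget (n t g : ℕ) : Set (Fin n) := {v | v.val / 2 / t = g}

variable {N : ℕ}

/-- The network of disjoint copies of `K_{t,t}`, with IDs in the natural order. -/
def gadgetNetwork (t m : ℕ) (hN : n ≤ N) : Network (Fin n) N := ⟨gadgetGraph n t m, Fin.castLEEmb hN⟩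

/-- The crossed network, with the same IDs. -/
def crossedNetwork (hN : n ≤ N) (hn : 2 * (t * m) ≤ n) (ht : 0 < t) (hP : IsPairing t m P) :
    Network (Fin n) N := ⟨crossedGraph hn ht hP, Fin.castLEEmb hN⟩

variable {hN : n ≤ N} {hn : 2 * (t * m) ≤ n} {ht : 0 < t} {hP : IsPairing t m P}

lemma gadgetNetwork_closed (g : ℕ) : (gadgetNetwork t m hN).Closed (gadget n t g) :=
  fun _ hu _ huv => huv.1.symm.trans hu

lemma crossedNetwork_closed (g : ℕ) :
    (crossedNetwork hN hn ht hP).Closed (gadget n t g) := by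
  intro u hu v huv
  have h := huv.1
  rw [cross_div_two] at h
  exact h.symm.trans hu

/-- The two nodes of a block have consecutive IDs, and before crossing a node knows only one of them
if the crossing exchanges them. Hence the crossing preserves the order of the known IDs. -/
lemma isRewiring_crossedNetwork :
    IsRewiring (gadgetNetwork t m hN) (crossedNetwork hN hn ht hP) (cross P) where
  id_eq := rfl
  involutive := cross_involutive P
  self := hP.cross_self
  adj_iff w x := by
    change (gadgetGraph n t m).Adj w (cross P w (cross P w x)) ↔ _
    rw [cross_involutive]
    rfl
  lt_iff w x y hx hy := by
    change (cross P w x).val < (cross P w y).val ↔ x.val < y.val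
    by_cases hb : x.val / 2 = y.val / 2
    · by_cases hc : Crossed P w x
      · -- Both are neighbours of `w`, hence on the same side of the gadget, hence equal.
        have hc' : Crossed P w y := (crossed_congr rfl hb.symm).2 hc
        have hxp := partner_val (block_lt hn (hP.of_crossed hc.symm).2.2 ht)
        have hyp := partner_val (block_lt hn (hP.of_crossed hc'.symm).2.2 ht)
        have hx' : w.val % 2 ≠ x.val % 2 := by
          rcases hx with hx | hx
          · exact hx.2.2
          · simp only [cross, if_pos hc] at hx
            rw [hx] at hxp
            omega
        have hy' : w.val % 2 ≠ y.val % 2 := by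
          rcases hy with hy | hy
          · exact hy.2.2
          · simp only [cross, if_pos hc'] at hy
            rw [hy] at hyp
            omega
        have : x = y := Fin.ext (by omega)
        rw [this]
        simp
      · have hc' : ¬Crossed P w y := fun h => hc ((crossed_congr rfl hb).2 h)
        simp only [cross, if_neg hc, if_neg hc']
    · have h1 := cross_div_two P w x
      have h2 := cross_div_two P w y
      omega

/-- A maximal independent set of `K_{t,t}` is one of the two sides. After crossing, each side contains
an edge, so no node set is a maximal independent set both before and after. -/
lemma not_isMISOn_crossed {p : ℕ × ℕ} (hp : p ∈ P) {d : Fin n → Bool}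
    (h : IsMISOn (gadgetGraph n t m) (gadget n t (p.1 / t)) d)
    (h' : IsMISOn (crossedGraph hn ht hP) (gadget n t (p.1 / t)) d) : False := by
  obtain ⟨a, b⟩ := p
  obtain ⟨hab, hg, hm⟩ := hP _ hp
  simp only at hab hg hm h h'
  have ha := block_lt hn hm ht
  have hb := block_lt hn (hg ▸ hm) ht
  obtain ⟨hind, hdom⟩ := h
  have hadj : ∀ u ∈ gadget n t (a / t), ∀ v ∈ gadget n t (a / t), u.val % 2 ≠ v.val % 2 →
      (gadgetGraph n t m).Adj u v := fun u hu v hv huv => ⟨hu.trans hv.symm, by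
        have : u.val / 2 / t = a / t := hu
        omega, huv⟩
  -- Two nodes on the same side have the same output.
  have hside : ∀ u ∈ gadget n t (a / t), ∀ v ∈ gadget n t (a / t), u.val % 2 = v.val % 2 →
      d u = true → d v = true := by
    intro u hu v hv huv hdu
    by_contra hdv
    obtain ⟨w, hw, hvw, hdw⟩ := hdom v hv (by simpa using hdv)
    have := hvw.2.2
    exact hind u hu w hw (hadj u hu w hw (by omega)) ⟨hdu, hdw⟩
  -- The crossed edges `{2a, 2b}` and `{2a+1, 2b+1}` join nodes on the same side.
  have hcross : ∀ i < 2, ∀ (hai : 2 * a + i < n) (hbi : 2 * b + i < n),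
      d ⟨2 * a + i, hai⟩ = true → False := by
    intro i hi hai hbi hd
    have hda : (2 * a + i) / 2 = a := by omega
    have hdb : (2 * b + i) / 2 = b := by omega
    have hA : (⟨2 * a + i, hai⟩ : Fin n) ∈ gadget n t (a / t) := by simp [gadget, hda]
    have hB : (⟨2 * b + i, hbi⟩ : Fin n) ∈ gadget n t (a / t) := by simp [gadget, hdb, hg]
    refine h'.1 _ hA _ hB ?_ ⟨hd, hside _ hA _ hB (by simp) hd⟩
    have hc : Crossed P (⟨2 * a + i, hai⟩ : Fin n) ⟨2 * b + i, hbi⟩ := by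
      left
      simpa [hda, hdb] using hp
    have hpar := partner_val (v := (⟨2 * b + i, hbi⟩ : Fin n)) (by simp only [hdb]; omega)
    change (gadgetGraph n t m).Adj _ (cross P _ _)
    simp only [cross, if_pos hc]
    refine hadj _ hA _ ?_ ?_
    · have := partner_div_two (⟨2 * b + i, hbi⟩ : Fin n)
      simp only [gadget, Set.mem_ofPred_eq, this, hdb, hg]
    · simp only at hpar ⊢
      omega
  have hA : (⟨2 * a, by omega⟩ : Fin n) ∈ gadget n t (a / t) := by simp [gadget]
  by_cases hd : d ⟨2 * a, by omega⟩ = true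
  · exact hcross 0 (by omega) (by omega) (by omega) hd
  · obtain ⟨w, hw, haw, hdw⟩ := hdom _ hA (by simpa using hd)
    refine hcross 1 (by omega) (by omega) (by omega) (hside w hw _ ?_ ?_ hdw)
    · have : (2 * a + 1) / 2 = a := by omega
      simp [gadget, this]
    · have := haw.2.2
      simp only at this ⊢
      omega

end Construction

/-! ### Pairs of blocks touched by an execution -/

namespace Algorithm

variable {A : Algorithm} {n N t m : ℕ} {P : Set (ℕ × ℕ)}

variable (A) in
/-- In the round that starts from `c`, a message travels between the blocks `p.1` and `p.2`, or a
message from or to a node in one of them carries an ID from the other one. -/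
def Touches (nw : Network (Fin n) N) (p : ℕ × ℕ) (c : A.Config (Fin n) N) : Prop :=
  ∃ u v, nw.graph.Adj u v ∧ ∃ msg, A.sent nw c u v = some msg ∧ (Crossed {p} u v ∨
    ∃ x, nw.id x ∈ msg.ids ∧ (Crossed {p} u x ∨ Crossed {p} v x))

lemma quiet_of_not_touches {hN : n ≤ N} {p : ℕ × ℕ} {c : A.Config (Fin n) N}
    (hP : IsPairing t m P) (huniq : ∀ q ∈ P, q.1 / t = p.1 / t → q = p)
    (h : ¬A.Touches (gadgetNetwork t m hN) p c) :
    A.Quiet (gadgetNetwork t m hN) (cross P) (gadget n t (p.1 / t)) c := by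
  have hred : ∀ u ∈ gadget n t (p.1 / t), ∀ x, Crossed P u x → Crossed {p} u x := by
    rintro u hu x (hc | hc)
    · exact .inl (huniq _ hc hu)
    · exact .inr (huniq _ hc ((hP _ hc).2.1.trans hu))
  intro u hu v huv msg hmsg
  have hv := gadgetNetwork_closed _ u hu v huv
  refine ⟨if_neg fun hc => h ⟨u, v, huv, msg, hmsg, .inl (hred u hu v hc)⟩,
    if_neg fun hc => h ⟨u, v, huv, msg, hmsg, .inl (hred v hv u hc).symm⟩, fun x hx => ⟨?_, ?_⟩⟩
  · exact if_neg fun hc => h ⟨u, v, huv, msg, hmsg, .inr ⟨x, hx, .inl (hred u hu x hc)⟩⟩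
  · exact if_neg fun hc => h ⟨u, v, huv, msg, hmsg, .inr ⟨x, hx, .inr (hred v hv x hc)⟩⟩

/-- An execution that solves a gadget with the same seeds before and after crossing must touch the
crossed pair of blocks. -/
lemma solvedOn_inter_subset_touches {hN : n ≤ N} {hn : 2 * (t * m) ≤ n} {ht : 0 < t}
    {hP : IsPairing t m P} {p : ℕ × ℕ} (hp : p ∈ P) (huniq : ∀ q ∈ P, q.1 / t = p.1 / t → q = p) :
    A.solvedOn (gadgetNetwork t m hN) (gadget n t (p.1 / t)) ∩
      A.solvedOn (crossedNetwork hN hn ht hP) (gadget n t (p.1 / t)) ⊆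
      {ω | ∃ r, A.Touches (gadgetNetwork t m hN) p (A.config (gadgetNetwork t m hN) ω r)} := by
  rintro ω ⟨⟨d, hd, hout⟩, d', hd', hout'⟩
  by_contra hno
  simp only [Set.mem_ofPred_eq, not_exists] at hno
  obtain ⟨r, hr, hr'⟩ := (hout.and hout').exists
  have hsim := similar_config
    (isRewiring_crossedNetwork (hN := hN) (hn := hn) (ht := ht) (hP := hP))
    (gadgetNetwork_closed (p.1 / t)) (crossedNetwork_closed (p.1 / t)) ω r
    fun s _ => quiet_of_not_touches (A := A) hP huniq (hno s)
  have heq : ∀ v ∈ gadget n t (p.1 / t), d' v = d v := by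
    intro v hv
    have := hr' v hv
    rw [(hsim v hv).1, hr v hv] at this
    exact (Option.some.inj this).symm
  refine not_isMISOn_crossed hp hd (hP := hP) (hn := hn) (ht := ht) ⟨fun u hu v hv huv => ?_,
    fun u hu hdu => ?_⟩
  · rw [← heq u hu, ← heq v hv]
    exact hd'.1 u hu v hv huv
  · obtain ⟨v, hv, huv, hdv⟩ := hd'.2 u hu (by rw [heq u hu, hdu])
    exact ⟨v, hv, huv, by rw [← heq v hv, hdv]⟩

/-- A message with at most `κ` IDs touches at most `2 + 4 * κ` ordered pairs of blocks. -/
lemma card_touches_le {κ : ℕ} {hN : n ≤ N} (hA : A.IsCongest κ n) (c : A.Config (Fin n) N)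
    (S : Finset (ℕ × ℕ)) (hS : ∀ p ∈ S, A.Touches (gadgetNetwork t m hN) p c) :
    S.card ≤ (2 + 4 * κ) * A.roundMessages (gadgetNetwork t m hN) c := by
  classical
  set nw := gadgetNetwork t m hN
  let senders : Finset (Σ _ : Fin n, Fin n) := Finset.univ.sigma fun u =>
    ((nw.nbrs u).filter fun v => (A.sent nw c u v).isSome).toFinset
  let pairs : (Σ _ : Fin n, Fin n) → Finset (ℕ × ℕ) := fun e =>
    ((A.sent nw c e.1 e.2).elim [] fun msg =>
      [(e.1.val / 2, e.2.val / 2), (e.2.val / 2, e.1.val / 2)] ++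
        msg.ids.flatMap fun a => [(e.1.val / 2, a.val / 2), (a.val / 2, e.1.val / 2),
          (e.2.val / 2, a.val / 2), (a.val / 2, e.2.val / 2)]).toFinset
  have hcard : senders.card = A.roundMessages nw c := by
    rw [Finset.card_sigma, roundMessages]
    refine Finset.sum_congr rfl fun u _ => ?_
    rw [List.toFinset_card_of_nodup ((nw.nodup_nbrs u).filter _), List.countP_eq_length_filter]
  have hpairs : ∀ e ∈ senders, (pairs e).card ≤ 2 + 4 * κ := by
    intro e _
    refine (List.toFinset_card_le _).trans ?_
    cases hm : A.sent nw c e.1 e.2 with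
    | none => simp
    | some msg =>
      have hlen : msg.ids.length ≤ κ := by
        simp only [sent, Option.map_eq_some_iff] at hm
        obtain ⟨m0, hm0, rfl⟩ := hm
        exact (List.length_filterMap_le _ _).trans (hA _ _ _ hm0).2
      simp [List.length_flatMap]
      omega
  have hsub : S ⊆ senders.biUnion pairs := by
    intro p hp
    obtain ⟨u, v, huv, msg, hmsg, htouch⟩ := hS p hp
    refine Finset.mem_biUnion.2 ⟨⟨u, v⟩, ?_, ?_⟩
    · simp [senders, Network.mem_nbrs, huv, hmsg]
    · simp only [pairs, hmsg, Option.elim, List.mem_toFinset, List.mem_append, List.mem_flatMap]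
      simp only [Crossed, Set.mem_singleton_iff] at htouch
      rcases htouch with (h | h) | ⟨x, hx, (h | h) | (h | h)⟩
      · exact .inl (by simp [h])
      · exact .inl (by simp [h])
      all_goals exact .inr ⟨_, hx, by simp [← h, nw, gadgetNetwork]⟩
  calc S.card ≤ (senders.biUnion pairs).card := Finset.card_le_card hsub
    _ ≤ senders.card * (2 + 4 * κ) := Finset.card_biUnion_le_card_mul _ _ _ hpairs
    _ = _ := by rw [hcard, mul_comm]

end Algorithm

/-! ### The number of gadgets and the expected number of messages -/

lemma mul_add_div_of_lt {t g i : ℕ} (hi : i < t) : (g * t + i) / t = g := by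
  rw [mul_comm, Nat.mul_add_div (by omega), Nat.div_eq_of_lt hi, add_zero]

/-- If `a i` and `b i` are probabilities with `a i + b i ≤ 1 + δ i`, where the `δ i` are at most `1 / 4`
on average, then `∏ a i` and `∏ b i` cannot both be at least `x` once there are many factors. -/
lemma prod_lt_of_add_le {m : ℕ} {a b δ : ℕ → ℝ} {x : ℝ} (hx : 0 < x) (hm : 0 < m)
    (hmx : -4 * Real.log x ≤ m) (ha : ∀ g, 0 ≤ a g) (hb : ∀ g, 0 ≤ b g)
    (hab : ∀ g < m, a g + b g ≤ 1 + δ g) (hδ : ∑ g ∈ Finset.range m, δ g ≤ m / 4)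
    (hxa : x ≤ ∏ g ∈ Finset.range m, a g) : ∏ g ∈ Finset.range m, b g < x := by
  by_contra! hxb
  have hfac : ∀ g ∈ Finset.range m, a g * b g ≤ (Real.exp (δ g) / 2) ^ 2 := by
    intro g hg
    have h1 := hab g (Finset.mem_range.1 hg)
    have h2 := Real.add_one_le_exp (δ g)
    have h3 : a g * b g ≤ ((a g + b g) / 2) ^ 2 := by nlinarith [sq_nonneg (a g - b g)]
    have h4 := ha g
    have h5 := hb g
    exact h3.trans (pow_le_pow_left₀ (by linarith) (by linarith) 2)
  have hsq : x ^ 2 ≤ (Real.exp (∑ g ∈ Finset.range m, δ g) / 2 ^ m) ^ 2 := by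
    calc x ^ 2 = x * x := sq x
      _ ≤ (∏ g ∈ Finset.range m, a g) * ∏ g ∈ Finset.range m, b g :=
          mul_le_mul hxa hxb hx.le (hx.le.trans hxa)
      _ = ∏ g ∈ Finset.range m, a g * b g := Finset.prod_mul_distrib.symm
      _ ≤ ∏ g ∈ Finset.range m, (Real.exp (δ g) / 2) ^ 2 :=
          Finset.prod_le_prod (fun g _ => mul_nonneg (ha g) (hb g)) hfac
      _ = _ := by
          rw [Finset.prod_pow, Finset.prod_div_distrib, Real.exp_sum, Finset.prod_const,
            Finset.card_range]
  have hle : x ≤ Real.exp (∑ g ∈ Finset.range m, δ g) / 2 ^ m :=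
    le_of_sq_le_sq hsq (by positivity)
  have hlog := Real.log_le_log hx hle
  rw [Real.log_div (Real.exp_pos _).ne' (by positivity), Real.log_exp, Real.log_pow] at hlog
  have hl2 := Real.log_two_gt_d9
  have hm' : (0 : ℝ) < m := Nat.cast_pos.2 hm
  nlinarith

/-- `x * log (1 / x)` is bounded, so the number of gadgets needed is `O(1 / x)`. -/
lemma mul_ceil_le {x : ℝ} (hx : 0 < x) (hx1 : x ≤ 1) :
    x * ((⌈-4 * Real.log x⌉₊ + 1 : ℕ) : ℝ) ≤ 6 := by
  have hlog : 0 ≤ -4 * Real.log x := by linarith [Real.log_nonpos hx.le hx1]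
  have h1 := (Nat.ceil_lt_add_one hlog).le
  have h2 := Real.one_sub_inv_le_log_of_pos hx
  have h3 : x * (1 - x⁻¹) = x - 1 := by field_simp
  have h4 := mul_le_mul_of_nonneg_left h2 hx.le
  push_cast
  nlinarith

/-- The number of pairs of blocks in a gadget is of the order of `(n / m) ^ 2`. -/
lemma sq_le_card_offDiag {n m : ℕ} (hm : 0 < m) (hn : 8 * m ≤ n) :
    (n : ℝ) ^ 2 ≤ 16 * (m : ℝ) ^ 2 * (Finset.range (n / (2 * m))).offDiag.card := by
  set t := n / (2 * m) with ht
  have h4 : 4 ≤ t := (Nat.le_div_iff_mul_le (by omega)).2 (by omega)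
  have hlt : n < 2 * m * (t + 1) := Nat.lt_mul_div_succ n (by omega)
  have hcard : (((Finset.range t).offDiag.card : ℕ) : ℝ) = (t : ℝ) * t - t := by
    rw [Finset.offDiag_card, Finset.card_range, Nat.cast_sub (Nat.le_mul_self t)]
    push_cast
    ring
  rw [hcard]
  have h4' : (4 : ℝ) ≤ t := by exact_mod_cast h4
  have hlt' : (n : ℝ) ≤ 2 * m * (t + 1) := by exact_mod_cast hlt.le
  calc (n : ℝ) ^ 2 ≤ (2 * m * (t + 1)) ^ 2 := pow_le_pow_left₀ (by positivity) hlt' 2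
    _ = 4 * (m : ℝ) ^ 2 * ((t : ℝ) + 1) ^ 2 := by ring
    _ ≤ 4 * (m : ℝ) ^ 2 * (4 * ((t : ℝ) * t - t)) := by gcongr; nlinarith
    _ = _ := by ring

/-- The probabilities that a pair of blocks of a common gadget is ever touched add up to
`O(κ)` times the expected number of messages. -/
lemma sum_touches_le {A : Algorithm} {κ n N t m : ℕ} (hN : n ≤ N) (hA : A.IsCongest κ n) :
    ∑ g ∈ Finset.range m, ∑ q ∈ (Finset.range t).offDiag, A.coinMeasure (Fin n)
      {ω | ∃ r, A.Touches (gadgetNetwork t m hN) (g * t + q.1, g * t + q.2)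
        (A.config (gadgetNetwork t m hN) ω r)} ≤
      ((2 + 4 * κ : ℕ) : ℝ≥0∞) * A.expectedMessages (gadgetNetwork t m hN) := by
  classical
  rw [← Finset.sum_product']
  let pr : ℕ × ℕ × ℕ → ℕ × ℕ := fun k => (k.1 * t + k.2.1, k.1 * t + k.2.2)
  refine Algorithm.sum_measure_exists_le (Finset.range m ×ˢ (Finset.range t).offDiag)
    (fun k => A.Touches (gadgetNetwork t m hN) (pr k)) (2 + 4 * κ) fun c s' hs' h => ?_
  have hinj : Set.InjOn pr s' := by
    rintro ⟨g, i, j⟩ hk ⟨g', i', j'⟩ hk' he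
    have h1 := hs' hk
    have h2 := hs' hk'
    simp only [Finset.mem_product, Finset.mem_offDiag, Finset.mem_range] at h1 h2
    simp only [pr, Prod.mk.injEq] at he
    have hg : g = g' := by rw [← mul_add_div_of_lt (g := g) h1.2.1, he.1, mul_add_div_of_lt h2.2.1]
    subst hg
    simp only [Prod.mk.injEq, true_and]
    omega
  rw [← Finset.card_image_of_injOn hinj]
  refine Algorithm.card_touches_le hA c _ fun p hp => ?_
  obtain ⟨k, hk, rfl⟩ := Finset.mem_image.1 hp
  exact h k hk

/-- If the algorithm errs with probability at most `ε` on every network, then it sends many messages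
on the disjoint union of `m` copies of `K_{t,t}`. -/
lemma le_expectedMessages {A : Algorithm} {κ n N t m : ℕ} {ε : ℝ} (hN : n ≤ N)
    (hA : A.IsCongest κ n) (hε : 0 ≤ ε) (hε1 : ε < 1)
    (herr : ∀ nw : Network (Fin n) N, A.errorProb nw ≤ ENNReal.ofReal ε)
    (hn : 2 * (t * m) ≤ n) (ht : 2 ≤ t) (hm : 0 < m) (hmε : -4 * Real.log (1 - ε) ≤ m) {M : ℝ}
    (hM0 : 0 ≤ M) (hM : (2 + 4 * κ) * M ≤ (Finset.range t).offDiag.card * (m / 4)) :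
    ENNReal.ofReal M ≤ A.expectedMessages (gadgetNetwork t m hN) := by
  by_contra! hlt
  set nw := gadgetNetwork t m hN
  set μ := A.coinMeasure (Fin n)
  set D := (Finset.range t).offDiag with hD
  have ht0 : 0 < t := by omega
  have hDne : D.Nonempty := ⟨(0, 1), by simp [hD]; omega⟩
  let touched : ℕ × ℕ → Set (Fin n × ℕ → ℕ) := fun p => {ω | ∃ r, A.Touches nw p (A.config nw ω r)}
  let pr : ℕ → ℕ × ℕ → ℕ × ℕ := fun g q => (g * t + q.1, g * t + q.2)
  have hsum : ∑ g ∈ Finset.range m, ∑ q ∈ D, μ.real (touched (pr g q)) ≤ (2 + 4 * κ) * M := by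
    have h := (sum_touches_le (t := t) (m := m) hN hA).trans (mul_le_mul_right hlt.le _)
    have h' := ENNReal.toReal_mono
      (ENNReal.mul_ne_top (ENNReal.natCast_ne_top _) ENNReal.ofReal_ne_top) h
    rw [ENNReal.toReal_sum fun g _ => ENNReal.sum_ne_top.2 fun q _ => measure_ne_top _ _,
      ENNReal.toReal_mul, ENNReal.toReal_natCast, ENNReal.toReal_ofReal hM0] at h'
    refine le_trans (le_of_eq (Finset.sum_congr rfl fun g _ => ?_)) (h'.trans (by push_cast; rfl))
    rw [ENNReal.toReal_sum fun q _ => measure_ne_top _ _]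
    rfl
  -- In every gadget, cross the pair of blocks that is least likely to be touched.
  choose q hqD hqmin using fun g =>
    D.exists_min_image (fun q => μ.real (touched (pr g q))) hDne
  have hq : ∀ g, (q g).1 < t ∧ (q g).2 < t ∧ (q g).1 ≠ (q g).2 := fun g => by
    simpa [hD] using hqD g
  have hδ : ∑ g ∈ Finset.range m, μ.real (touched (pr g (q g))) ≤ m / 4 := by
    have h : (D.card : ℝ) * ∑ g ∈ Finset.range m, μ.real (touched (pr g (q g))) ≤
        ∑ g ∈ Finset.range m, ∑ q ∈ D, μ.real (touched (pr g q)) := by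
      rw [Finset.mul_sum]
      refine Finset.sum_le_sum fun g _ => ?_
      rw [← nsmul_eq_mul]
      exact Finset.card_nsmul_le_sum _ _ _ (hqmin g)
    exact le_of_mul_le_mul_left ((h.trans hsum).trans hM) (by exact_mod_cast hDne.card_pos)
  let P : Set (ℕ × ℕ) := {p | ∃ g < m, p = pr g (q g)}
  have hP : IsPairing t m P := by
    rintro _ ⟨g, hg, rfl⟩
    obtain ⟨h1, h2, h3⟩ := hq g
    refine ⟨by simpa [pr] using h3, ?_, ?_⟩
    · simp only [pr, mul_add_div_of_lt h1, mul_add_div_of_lt h2]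
    · simpa only [pr, mul_add_div_of_lt h1] using hg
  set nw' := crossedNetwork hN hn ht0 hP
  have hsub : ∀ g < m, A.solvedOn nw (gadget n t g) ∩ A.solvedOn nw' (gadget n t g) ⊆
      touched (pr g (q g)) := by
    intro g hg
    have hpg : (pr g (q g)).1 / t = g := mul_add_div_of_lt (hq g).1
    have h := Algorithm.solvedOn_inter_subset_touches (A := A) (hN := hN) (hn := hn) (ht := ht0)
      (hP := hP) (p := pr g (q g)) ⟨g, hg, rfl⟩ (by
        rintro _ ⟨g', hg', rfl⟩ he
        rw [hpg, show (pr g' (q g')).1 / t = g' from mul_add_div_of_lt (hq g').1] at he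
        rw [he])
    rw [hpg] at h
    exact h
  have hprod : ∀ nw : Network (Fin n) N, (∀ g, nw.Closed (gadget n t g)) →
      1 - ε ≤ ∏ g ∈ Finset.range m, μ.real (A.solvedOn nw (gadget n t g)) := by
    intro nw hcl
    have h := Algorithm.one_sub_errorProb_le_prod (A := A) hcl
      (fun k l hkl => Set.disjoint_left.2 fun v hv hv' => hkl (hv.symm.trans hv')) (Finset.range m)
    have h' : ENNReal.ofReal (1 - ε) ≤ ∏ g ∈ Finset.range m, μ (A.solvedOn nw (gadget n t g)) := by
      rw [ENNReal.ofReal_sub _ hε, ENNReal.ofReal_one]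
      exact (tsub_le_tsub_left (herr nw) 1).trans h
    rw [ENNReal.ofReal_le_iff_le_toReal
      (ENNReal.prod_ne_top fun _ _ => measure_ne_top _ _), ENNReal.toReal_prod] at h'
    exact h'
  refine (prod_lt_of_add_le (by linarith) hm hmε (fun g => measureReal_nonneg)
    (fun g => measureReal_nonneg) (fun g hg => ?_) hδ
    (hprod nw fun g => gadgetNetwork_closed g)).not_ge (hprod nw' fun g => crossedNetwork_closed g)
  rw [← measureReal_union_add_inter (Algorithm.measurableSet_solvedOn _)]
  exact add_le_add measureReal_le_one (measureReal_mono (hsub g hg))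

end Congest

/-- Randomized comparison-based KT-1 CONGEST algorithms for MIS need `Ω((1 - ε) n²)` messages.
The algorithm `A` is chosen after `n` and the size `N` of the ID space, so it may depend on both:
the nodes know the size of the network. -/
theorem mainTheorem2 (κ : ℕ) :
    ∃ c : ℝ, 0 < c ∧ ∀ ε : ℝ, 0 ≤ ε → ε < 1 → ∃ n₀ : ℕ, ∀ n : ℕ, n₀ ≤ n → ∀ N : ℕ, n ≤ N →
      ∀ A : Congest.Algorithm, A.IsCongest κ n →
        (∀ nw : Congest.Network (Fin n) N, A.errorProb nw ≤ ENNReal.ofReal ε) →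
        ∃ nw : Congest.Network (Fin n) N,
          ENNReal.ofReal (c * (1 - ε) * (n : ℝ) ^ 2) ≤ A.expectedMessages nw := by
  have hK : (0 : ℝ) < 2 + 4 * κ := by positivity
  -- `384 = 16 * 6 * 4`: from the number of pairs, the number of gadgets, and `δ ≤ 1 / 4`.
  refine ⟨1 / (384 * (2 + 4 * κ)), by positivity, fun ε hε hε1 => ?_⟩
  have hx : 0 < 1 - ε := by linarith
  let m : ℕ := ⌈-4 * Real.log (1 - ε)⌉₊ + 1
  have hm : 0 < m := Nat.succ_pos _
  have hmε : -4 * Real.log (1 - ε) ≤ m := (Nat.le_ceil _).trans (by simp [m])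
  have hm6 : (1 - ε) * (m : ℝ) ≤ 6 := Congest.mul_ceil_le hx (by linarith)
  refine ⟨8 * m, fun n hn N hN A hA herr => ⟨Congest.gadgetNetwork (n / (2 * m)) m hN, ?_⟩⟩
  have ht : 4 ≤ n / (2 * m) := (Nat.le_div_iff_mul_le (by omega)).2 (by omega)
  have htm : 2 * (n / (2 * m) * m) ≤ n := by
    have := Nat.div_mul_le_self n (2 * m)
    calc 2 * (n / (2 * m) * m) = n / (2 * m) * (2 * m) := by ring
      _ ≤ n := this
  refine Congest.le_expectedMessages hN hA hε hε1 herr htm (by omega) hm hmε (by positivity) ?_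
  have hcard := Congest.sq_le_card_offDiag hm hn
  set k : ℝ := ((Finset.range (n / (2 * m))).offDiag.card : ℝ)
  have hk : 0 ≤ k := Nat.cast_nonneg _
  calc (2 + 4 * (κ : ℝ)) * (1 / (384 * (2 + 4 * κ)) * (1 - ε) * (n : ℝ) ^ 2)
      = (1 - ε) * (n : ℝ) ^ 2 / 384 := by field_simp
    _ ≤ (1 - ε) * (16 * (m : ℝ) ^ 2 * k) / 384 := by gcongr
    _ = ((1 - ε) * m) * (k * (m / 24)) := by ring
    _ ≤ 6 * (k * (m / 24)) := by gcongr
    _ = k * (m / 4) := by ring
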